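/- Let $(\Omega,\mathcal F,\mathbb P)$ be a probability space, $n\in\mathbb N$ and $T\ge 0$. Let $L_1,\dots,L_n$ be independent, increasing, pure jump Lévy processes ($L_i(t)$ is the sum of the jumps of $L_i$ up to time $t$) whose jump measures $N_i(dt,dz)$ have the predictable compensators $dt\,\nu_i(dz)$, and assume $\int_{(0,\infty)}z\,\nu_i(dz)<\infty$. Let $(\mathcal F_t)$ be the filtration generated by $L_1,\dots,L_n$. For each $i$ let $\lambda_i>0$ and $y_i\in\mathbb R$ be constants, let $\sigma_i$ be a deterministic, measurable, positive and bounded function on $[0,T]$, let $\Lambda_i$ be a deterministic positive function on $[0,T]$, and let $Y_i$ solve on $[0,T]$ $$dY_i(t)=-\lambda_iY_i(t)\,dt+\sigma_i(t)\,dL_i(t),\qquad Y_i(0)=y_i .$$ The spot price is $E(t)=\sum_{i=1}^n\Lambda_i(t)Y_i(t)$. Let $0\le T_1<T_2\le T$, assume that each $\Lambda_i$ is integrable on $[T_1,T_2]$, and let the price at time $t\le T_2$ of the futures with delivery period $[T_1,T_2]$ be $$F(t,T_1,T_2)=\mathbb E\Big[\frac1{T_2-T_1}\int_{T_1}^{T_2}E(u)\,du\,\Big|\,\mathcal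 F_t\Big].$$ Then almost surely $E$ is integrable on $[T_1,T_2]$, the payoff $\frac1{T_2-T_1}\int_{T_1}^{T_2}E(u)\,du$ is an integrable random variable, and the following hold almost surely, for each fixed $t$. If $0\le t\le T_1$, then $$F(t,T_1,T_2)=\sum_{i=1}^n Y_i(t)\frac1{T_2-T_1}\int_{T_1}^{T_2}\Lambda_i(u)e^{-\lambda_i(u-t)}\,du+\sum_{i=1}^n\frac1{T_2-T_1}\int_{T_1}^{T_2}\int_t^u\int_{(0,\infty)}\sigma_i(s)\Lambda_i(u)e^{-\lambda_i(u-s)}z\,\nu_i(dz)\,ds\,du .$$ If $T_1\le t\le T_2$, then $$F(t,T_1,T_2)=\frac1{T_2-T_1}\int_{T_1}^tE(u)\,du+\sum_{i=1}^n Y_i(t)\frac1{T_2-T_1}\int_t^{T_2}\Lambda_i(u)e^{-\lambda_i(u-t)}\,du+\sum_{i=1}^n\frac1{T_2-T_1}\int_t^{T_2}\int_t^u\int_{(0,\infty)}\sigma_i(s)\Lambda_i(u)e^{-\lambda_i(u-s)}z\,\nu_i(dz)\,ds\,du .$$ -/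

import Mathlib

open MeasureTheory ProbabilityTheory Set Filter Topology
open scoped NNReal ENNReal

noncomputable section

/-- The jump `Δf(s) = f(s) - f(s-)` of a path `f : [0,∞) → ℝ`; it is `0` at `s = 0`. -/
def pathJump (f : ℝ≥0 → ℝ) (s : ℝ≥0) : ℝ := f s - Function.leftLim f s

/-- The jump measure `N(ds, dz)` of a path: the sum of the unit masses at `(s, Δf(s))` over all
times `s` with `Δf(s) ≠ 0`. For a measurable set `B`, `N(B)` is the number of `s` with
`Δf(s) ≠ 0` and `(s, Δf(s)) ∈ B`. -/
def jumpMeasure (f : ℝ≥0 → ℝ) : Measure (ℝ≥0 × ℝ) :=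
  Measure.sum fun s : {s : ℝ≥0 // pathJump f s ≠ 0} => Measure.dirac (s.1, pathJump f s.1)

open Classical in
/-- The Lebesgue–Stieltjes measure `df` on `ℝ` of an increasing right-continuous path
`f : [0,∞) → ℝ` (extended by `f(0)` to negative times, so that `df` has no mass in `(-∞, 0]`). -/
def pathStieltjes (f : ℝ≥0 → ℝ) : Measure ℝ :=
  if hf : Monotone f then
    (show Monotone fun x : ℝ => f x.toNNReal from
      fun _ _ hxy => hf (Real.toNNReal_mono hxy)).stieltjesFunction.measure
  else 0

/-- A real-valued Lévy process: it starts at `0`, has independent and stationary increments,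
and has càdlàg paths. -/
structure IsLevyProcess {Ω : Type*} {mΩ : MeasurableSpace Ω} (L : ℝ≥0 → Ω → ℝ)
    (P : Measure Ω) : Prop where
  measurable : ∀ t, Measurable (L t)
  start_zero : ∀ ω, L 0 ω = 0
  indep_increments : HasIndepIncrements L P
  stationary_increments :
    ∀ s h : ℝ≥0, IdentDistrib (fun ω => L (s + h) ω - L s ω) (L h) P P
  right_continuous : ∀ ω t, ContinuousWithinAt (fun s => L s ω) (Ici t) t
  left_limits : ∀ ω t, ∃ l : ℝ, Tendsto (fun s => L s ω) (𝓝[<] t) (𝓝 l)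

/-- An increasing pure jump Lévy process with Lévy measure `ν`: its paths are increasing and equal
to the sum of their jumps, and the jump measure `N` has intensity `dt ν(dz)`, that is,
`E[N((s,t] × A)] = (t - s) ν(A)`. As `L` is a Lévy process, this says that the predictable
compensator of `N` is the deterministic measure `dt ν(dz)`. -/
structure IsIncreasingPureJumpLevy {Ω : Type*} {mΩ : MeasurableSpace Ω} (L : ℝ≥0 → Ω → ℝ)
    (ν : Measure ℝ) (P : Measure Ω) : Prop extends IsLevyProcess L P where
  monotone_paths : ∀ ω, Monotone fun s => L s ω
  pure_jump :
    ∀ ω (t : ℝ≥0), HasSum (fun s : Ioc 0 t => pathJump (fun r => L r ω) s) (L t ω)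
  jump_intensity : ∀ s t : ℝ≥0, s ≤ t → ∀ A : Set ℝ, MeasurableSet A →
    ∫⁻ ω, jumpMeasure (fun r => L r ω) (Ioc s t ×ˢ A) ∂P = ((t - s : ℝ≥0) : ℝ≥0∞) * ν A

/-- `Y` solves `dY(t) = -lam Y(t) dt + σ(t) dL(t)`, `Y(0) = y`, on `[0, T]`, for a driving process
`L` with increasing right-continuous paths: almost surely,
`Y(t) = y - ∫₀ᵗ lam Y(s) ds + ∫_{(0,t]} σ(s) dL(s)` for all `t ∈ [0, T]`, where the last integral
is the pathwise Lebesgue–Stieltjes integral. -/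
def IsOUSolution {Ω : Type*} {mΩ : MeasurableSpace Ω} (T : ℝ≥0) (lam y : ℝ) (σ : ℝ → ℝ)
    (L Y : ℝ≥0 → Ω → ℝ) (P : Measure Ω) : Prop :=
  ∀ᵐ ω ∂P, IntervalIntegrable (fun s : ℝ => Y s.toNNReal ω) volume 0 T ∧
    ∀ t : ℝ≥0, t ≤ T →
      Y t ω = y - (∫ s in (0 : ℝ)..t, lam * Y s.toNNReal ω)
        + ∫ s in Ioc (0 : ℝ) t, σ s ∂(pathStieltjes fun r => L r ω)

/-- The filtration generated by the processes `L 0, …, L (n-1)`: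
`ℱ t` is generated by all `L i s` with `s ≤ t`. -/
def generatedFiltration {Ω : Type*} {mΩ : MeasurableSpace Ω} {n : ℕ} (L : Fin n → ℝ≥0 → Ω → ℝ)
    (hL : ∀ i t, Measurable (L i t)) : Filtration ℝ≥0 mΩ :=
  Filtration.natural (fun t ω i => L i t ω)
    fun t => (measurable_pi_lambda _ fun i => hL i t).stronglyMeasurable

/-- The spot price `E(t) = ∑ᵢ Λᵢ(t) Yᵢ(t)`. -/
def spotPrice {Ω : Type*} {n : ℕ} (Λ : Fin n → ℝ → ℝ) (Y : Fin n → ℝ≥0 → Ω → ℝ)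
    (t : ℝ≥0) (ω : Ω) : ℝ := ∑ i, Λ i t * Y i t ω

/-- The payoff `(T₂ - T₁)⁻¹ ∫_{T₁}^{T₂} E(u) du` of the futures. -/
def futuresPayoff {Ω : Type*} (E : ℝ≥0 → Ω → ℝ) (T₁ T₂ : ℝ≥0) (ω : Ω) : ℝ :=
  1 / ((T₂ : ℝ) - T₁) * ∫ u in (T₁ : ℝ)..T₂, E u.toNNReal ω

/-- The futures price `F(t; T₁, T₂)`: the conditional expectation of the payoff given `ℱ t`. -/
def futuresPrice {Ω : Type*} {mΩ : MeasurableSpace Ω} (P : Measure Ω) (ℱ : Filtration ℝ≥0 mΩ)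
    (E : ℝ≥0 → Ω → ℝ) (T₁ T₂ t : ℝ≥0) : Ω → ℝ :=
  P[futuresPayoff E T₁ T₂ | ℱ t]

end

/-!
By the integrating factor `e^{λt}` and Fubini's theorem for the pathwise Stieltjes integral,
`∫ₐᵇ E(u) du` with `t ≤ a` is a linear combination of the `Yᵢ(t)` plus, for each `i`, the integral
over `(t, b]` of a deterministic function against `dLᵢ`. The first part is known at time `t`. The
second is a function of the increments of the `Lᵢ` after `t`, hence independent of `ℱ t` and
predicted by its mean, and `E[dLᵢ(s)] = (∫ z νᵢ(dz)) ds` because `Lᵢ` is the sum of its jumps.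
-/

section Path

variable {f : ℝ≥0 → ℝ}

lemma rightLim_comp_toNNReal (hrc : ∀ t, ContinuousWithinAt f (Ici t) t) (x : ℝ) :
    Function.rightLim (fun x : ℝ => f x.toNNReal) x = f x.toNNReal :=
  ContinuousWithinAt.rightLim_eq <|
    (hrc x.toNNReal).comp continuous_real_toNNReal.continuousWithinAt
      fun _ hz => Real.toNNReal_mono hz

lemma pathStieltjes_Ioc (hf : Monotone f) (hrc : ∀ t, ContinuousWithinAt f (Ici t) t) (a b : ℝ) :
    pathStieltjes f (Ioc a b) = ENNReal.ofReal (f b.toNNReal - f a.toNNReal) := by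
  rw [pathStieltjes, dif_pos hf, StieltjesFunction.measure_Ioc]
  simp only [Monotone.stieltjesFunction_eq, rightLim_comp_toNNReal hrc]

instance (f : ℝ≥0 → ℝ) : IsLocallyFiniteMeasure (pathStieltjes f) := by
  unfold pathStieltjes
  split_ifs <;> infer_instance

instance (f : ℝ≥0 → ℝ) (a b : ℝ) : IsFiniteMeasure ((pathStieltjes f).restrict (Ioc a b)) :=
  isFiniteMeasure_restrict.2 measure_Ioc_lt_top.ne

lemma pathJump_nonneg (hf : Monotone f) (s : ℝ≥0) : 0 ≤ pathJump f s :=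
  sub_nonneg.2 (hf.leftLim_le le_rfl)

lemma pathJump_zero (f : ℝ≥0 → ℝ) : pathJump f 0 = 0 := by
  rw [pathJump, leftLim_eq_of_isBot fun s => zero_le (a := s), sub_self]

lemma tsum_Ioc_pathJump (hf : Monotone f)
    (hjump : ∀ t : ℝ≥0, HasSum (fun s : Ioc 0 t => pathJump f s) (f t)) {c d : ℝ≥0}
    (hcd : c ≤ d) :
    ∑' s : Ioc c d, ENNReal.ofReal (pathJump f s) = ENNReal.ofReal (f d - f c) := by
  have hsum (t : ℝ≥0) : ∑' s : Ioc 0 t, ENNReal.ofReal (pathJump f s) = ENNReal.ofReal (f t) := by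
    rw [← ENNReal.ofReal_tsum_of_nonneg (fun s : Ioc 0 t => pathJump_nonneg hf s)
      (hjump t).summable, (hjump t).tsum_eq]
  have hc : 0 ≤ f c := (hjump c).nonneg fun s : Ioc 0 c => pathJump_nonneg hf s
  have hunion := ENNReal.summable.tsum_union_disjoint (f := fun s => ENNReal.ofReal (pathJump f s))
    (Ioc_disjoint_Ioc_of_le (le_refl c)) ENNReal.summable (s := Ioc 0 c) (t := Ioc c d)
  rw [Ioc_union_Ioc_eq_Ioc zero_le hcd, hsum, hsum] at hunion
  rw [ENNReal.ofReal_sub _ hc, hunion, ENNReal.add_sub_cancel_left ENNReal.ofReal_ne_top]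

lemma pathStieltjes_eq_sum_dirac (hf : Monotone f)
    (hrc : ∀ t, ContinuousWithinAt f (Ici t) t)
    (hjump : ∀ t : ℝ≥0, HasSum (fun s : Ioc 0 t => pathJump f s) (f t)) :
    pathStieltjes f =
      Measure.sum fun s : ℝ≥0 => ENNReal.ofReal (pathJump f s) • Measure.dirac (s : ℝ) := by
  refine Measure.ext_of_Ioc _ _ fun a b hab => ?_
  rw [pathStieltjes_Ioc hf hrc, ← tsum_Ioc_pathJump hf hjump (Real.toNNReal_mono hab.le),
    Measure.sum_apply _ measurableSet_Ioc,
    tsum_subtype _ fun s => ENNReal.ofReal (pathJump f s)]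
  refine tsum_congr fun s => ?_
  rcases eq_or_ne s 0 with rfl | hs
  · simp [pathJump_zero, indicator]
  · have hmem : s ∈ Ioc a.toNNReal b.toNNReal ↔ (s : ℝ) ∈ Ioc a b := by
      have hpos : 0 < s := pos_iff_ne_zero.2 hs
      rw [mem_Ioc, mem_Ioc, Real.le_toNNReal_iff_coe_le' hpos]
      nth_rewrite 1 [← Real.toNNReal_coe (r := s)]
      rw [Real.toNNReal_lt_toNNReal_iff (NNReal.coe_pos.2 hpos)]
    simp [indicator, hmem]

lemma pathStieltjes_singleton (hf : Monotone f) (hrc : ∀ t, ContinuousWithinAt f (Ici t) t)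
    (hjump : ∀ t : ℝ≥0, HasSum (fun s : Ioc 0 t => pathJump f s) (f t)) (s : ℝ≥0) :
    pathStieltjes f {(s : ℝ)} = ENNReal.ofReal (pathJump f s) := by
  rw [pathStieltjes_eq_sum_dirac hf hrc hjump, Measure.sum_apply _ (measurableSet_singleton _),
    tsum_eq_single s fun r hr => by simp [hr]]
  simp

lemma lintegral_pathStieltjes (hf : Monotone f) (hrc : ∀ t, ContinuousWithinAt f (Ici t) t)
    (hjump : ∀ t : ℝ≥0, HasSum (fun s : Ioc 0 t => pathJump f s) (f t)) (h : ℝ → ℝ≥0∞) :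
    ∫⁻ s, h s ∂(pathStieltjes f) = ∑' s : ℝ≥0, ENNReal.ofReal (pathJump f s) * h s := by
  simp only [pathStieltjes_eq_sum_dirac hf hrc hjump, lintegral_sum_measure,
    lintegral_smul_measure, lintegral_dirac, smul_eq_mul]

lemma lintegral_jumpMeasure (f : ℝ≥0 → ℝ) (h : ℝ≥0 × ℝ → ℝ≥0∞) :
    ∫⁻ p, h p ∂(jumpMeasure f)
      = ∑' s : ℝ≥0, {s | pathJump f s ≠ 0}.indicator (fun s => h (s, pathJump f s)) s := by
  rw [← tsum_subtype, jumpMeasure, lintegral_sum_measure]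
  simp only [lintegral_dirac]
  rfl

lemma setLIntegral_jumpMeasure_ofReal_snd_mul (hf : Monotone f)
    (hrc : ∀ t, ContinuousWithinAt f (Ici t) t)
    (hjump : ∀ t : ℝ≥0, HasSum (fun s : Ioc 0 t => pathJump f s) (f t)) (h : ℝ → ℝ≥0∞)
    (c d : ℝ≥0) :
    ∫⁻ p in Ioc c d ×ˢ univ, ENNReal.ofReal p.2 * h p.2 ∂(jumpMeasure f)
      = ∫⁻ s in Ioc (c : ℝ) d, h (pathStieltjes f {s}).toReal ∂(pathStieltjes f) := by
  rw [← lintegral_indicator (measurableSet_Ioc.prod .univ), ← lintegral_indicator measurableSet_Ioc,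
    lintegral_jumpMeasure, lintegral_pathStieltjes hf hrc hjump]
  refine tsum_congr fun s => ?_
  rcases eq_or_ne (pathJump f s) 0 with hs | hs
  · simp [hs]
  · simp [hs, indicator, pathStieltjes_singleton hf hrc hjump,
      ENNReal.toReal_ofReal (pathJump_nonneg hf s)]

-- A jump `z` is an atom of `df` of mass `z`, so integrating the reciprocals of the atoms against
-- `df` counts the jumps. The jump counts are thus measurable functions of the random measure `df`.
lemma jumpMeasure_Ioc_prod (hf : Monotone f) (hrc : ∀ t, ContinuousWithinAt f (Ici t) t)
    (hjump : ∀ t : ℝ≥0, HasSum (fun s : Ioc 0 t => pathJump f s) (f t)) (c d : ℝ≥0)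
    {A : Set ℝ} (hA : MeasurableSet A) :
    jumpMeasure f (Ioc c d ×ˢ A) = ∫⁻ s in Ioc (c : ℝ) d,
      A.indicator (fun z => (ENNReal.ofReal z)⁻¹) (pathStieltjes f {s}).toReal
        ∂(pathStieltjes f) := by
  rw [← setLIntegral_jumpMeasure_ofReal_snd_mul hf hrc hjump,
    ← lintegral_indicator (measurableSet_Ioc.prod .univ),
    ← lintegral_indicator_one (measurableSet_Ioc.prod hA),
    lintegral_jumpMeasure, lintegral_jumpMeasure]
  refine tsum_congr fun s => congrFun (indicator_congr fun s hs => ?_) s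
  have hpos : 0 < pathJump f s := (pathJump_nonneg hf s).lt_of_ne' hs
  have hcancel : ENNReal.ofReal (pathJump f s) * (ENNReal.ofReal (pathJump f s))⁻¹ = 1 :=
    ENNReal.mul_inv_cancel (ENNReal.ofReal_pos.2 hpos).ne' ENNReal.ofReal_ne_top
  by_cases hA : pathJump f s ∈ A <;> simp [indicator, hA, hcancel]

lemma setLIntegral_jumpMeasure_ofReal_snd (hf : Monotone f)
    (hrc : ∀ t, ContinuousWithinAt f (Ici t) t)
    (hjump : ∀ t : ℝ≥0, HasSum (fun s : Ioc 0 t => pathJump f s) (f t)) (c d : ℝ≥0) :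
    ∫⁻ p in Ioc c d ×ˢ univ, ENNReal.ofReal p.2 ∂(jumpMeasure f)
      = ENNReal.ofReal (f d - f c) := by
  simpa [pathStieltjes_Ioc hf hrc] using
    setLIntegral_jumpMeasure_ofReal_snd_mul hf hrc hjump 1 c d

end Path

lemma isSFiniteKernel_of_forall_isFiniteMeasure {α β : Type*} {mα : MeasurableSpace α}
    {mβ : MeasurableSpace β} (κ : Kernel α β) [∀ a, IsFiniteMeasure (κ a)] :
    IsSFiniteKernel κ := by
  have hmass : Measurable fun a => 1 + κ a univ := (κ.measurable_coe .univ).const_add 1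
  let η : Kernel α β :=
    ⟨fun a => (1 + κ a univ)⁻¹ • κ a, Measure.measurable_of_measurable_coe _ fun s hs =>
      hmass.inv.mul (κ.measurable_coe hs)⟩
  have hη (a : α) : η a = (1 + κ a univ)⁻¹ • κ a := rfl
  have : IsFiniteKernel η := by
    refine ⟨1, ENNReal.one_lt_top, fun a => ?_⟩
    rw [hη, Measure.smul_apply, smul_eq_mul, mul_comm, ← div_eq_mul_inv]
    exact ENNReal.div_le_of_le_mul (by rw [one_mul]; exact le_add_self)
  have hκ : κ = η.withDensity fun a _ => 1 + κ a univ := by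
    ext a : 1
    rw [Kernel.withDensity_apply _ (by exact hmass.comp measurable_fst), withDensity_const, hη,
      smul_smul, ENNReal.mul_inv_cancel (by simp) (by simp), one_smul]
  rw [hκ]
  exact Kernel.IsSFiniteKernel.withDensity η fun a _ => by simp

section RandomPath

variable {Ω : Type*} {L : ℝ≥0 → Ω → ℝ}

lemma measurable_pathStieltjes_restrict {m : MeasurableSpace Ω}
    (hmono : ∀ ω, Monotone fun t => L t ω)
    (hrc : ∀ ω t, ContinuousWithinAt (fun s => L s ω) (Ici t) t) {a b : ℝ≥0}
    (hmeas : ∀ c d, a ≤ c → c ≤ d → d ≤ b → Measurable fun ω => L d ω - L c ω) :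
    Measurable fun ω => (pathStieltjes fun r => L r ω).restrict (Ioc (a : ℝ) b) := by
  have hIoc (c d : ℝ) (hac : a ≤ c) (hdb : d ≤ b) :
      Measurable fun ω => pathStieltjes (fun r => L r ω) (Ioc c d) := by
    rcases le_total d c with hdc | hcd
    · simp only [Ioc_eq_empty_of_le hdc, measure_empty, measurable_const]
    · simp only [pathStieltjes_Ioc (hmono _) (hrc _)]
      exact (hmeas _ _ (NNReal.le_toNNReal_of_coe_le hac) (Real.toNNReal_mono hcd)
        (Real.toNNReal_le_iff_le_coe.2 hdb)).ennreal_ofReal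
  refine Measurable.measure_of_isPiSystem
    (BorelSpace.measurable_eq.trans (borel_eq_generateFrom_Ioc ℝ)) (isPiSystem_Ioc id id) ?_ ?_
  · rintro _ ⟨l, u, _, rfl⟩
    simp only [Measure.restrict_apply measurableSet_Ioc, Ioc_inter_Ioc]
    exact hIoc _ _ le_sup_right inf_le_right
  · simpa only [Measure.restrict_apply_univ] using hIoc _ _ le_rfl le_rfl

end RandomPath

namespace IsIncreasingPureJumpLevy

variable {Ω : Type*} {mΩ : MeasurableSpace Ω} {P : Measure Ω} {L : ℝ≥0 → Ω → ℝ} {ν : Measure ℝ}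

/-- The random measure `dL` on `(a, b]`, as a kernel from the sample space to the time axis. -/
noncomputable def pathKernel (hL : IsIncreasingPureJumpLevy L ν P) (a b : ℝ≥0) : Kernel Ω ℝ :=
  ⟨fun ω => (pathStieltjes fun r => L r ω).restrict (Ioc (a : ℝ) b),
    measurable_pathStieltjes_restrict hL.monotone_paths hL.right_continuous
      fun c d _ _ _ => (hL.measurable d).sub (hL.measurable c)⟩

lemma pathKernel_apply (hL : IsIncreasingPureJumpLevy L ν P) (a b : ℝ≥0) (ω : Ω) :
    hL.pathKernel a b ω = (pathStieltjes fun r => L r ω).restrict (Ioc (a : ℝ) b) :=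
  rfl

instance (hL : IsIncreasingPureJumpLevy L ν P) (a b : ℝ≥0) : IsSFiniteKernel (hL.pathKernel a b) :=
  have (ω : Ω) : IsFiniteMeasure (hL.pathKernel a b ω) := by
    rw [pathKernel_apply]; infer_instance
  isSFiniteKernel_of_forall_isFiniteMeasure _

lemma measurable_jumpMeasure_Ioc_prod (hL : IsIncreasingPureJumpLevy L ν P) (c d : ℝ≥0)
    {A : Set ℝ} (hA : MeasurableSet A) :
    Measurable fun ω => jumpMeasure (fun r => L r ω) (Ioc c d ×ˢ A) := by
  have hatom : Measurable fun p : Ω × ℝ => (hL.pathKernel c d p.1 {p.2}).toReal :=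
    (Kernel.measurable_kernel_prodMk_left (κ := Kernel.prodMkRight ℝ (hL.pathKernel c d))
      (measurableSet_eq_fun measurable_snd
        (measurable_snd.comp (measurable_fst (β := ℝ))))).ennreal_toReal
  have hweight : Measurable (A.indicator fun z : ℝ => (ENNReal.ofReal z)⁻¹) :=
    ENNReal.measurable_ofReal.inv.indicator hA
  convert (hweight.comp hatom).lintegral_kernel_prod_right' (κ := hL.pathKernel c d) using 2 with ω
  rw [jumpMeasure_Ioc_prod (hL.monotone_paths ω) (hL.right_continuous ω) (hL.pure_jump ω) c d hA,
    pathKernel_apply]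
  refine setLIntegral_congr_fun measurableSet_Ioc fun s hs => ?_
  simp only [Function.comp_apply, pathKernel_apply,
    Measure.restrict_apply (measurableSet_singleton s),
    inter_eq_left.2 (singleton_subset_iff.2 hs)]

lemma lintegral_lintegral_jumpMeasure (hL : IsIncreasingPureJumpLevy L ν P) {c d : ℝ≥0}
    (hcd : c ≤ d) {g : ℝ → ℝ≥0∞} (hg : Measurable g) :
    ∫⁻ ω, ∫⁻ p in Ioc c d ×ˢ univ, g p.2 ∂(jumpMeasure fun r => L r ω) ∂P
      = ((d - c : ℝ≥0) : ℝ≥0∞) * ∫⁻ z, g z ∂ν := by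
  let sizes (ω : Ω) : Measure ℝ :=
    ((jumpMeasure fun r => L r ω).restrict (Ioc c d ×ˢ univ)).map Prod.snd
  have sizes_apply (ω : Ω) {A : Set ℝ} (hA : MeasurableSet A) :
      sizes ω A = jumpMeasure (fun r => L r ω) (Ioc c d ×ˢ A) := by
    rw [Measure.map_apply measurable_snd hA, Measure.restrict_apply (measurable_snd hA)]
    congr 1
    ext p
    simp [and_comm]
  have hsizes : Measurable sizes := Measure.measurable_of_measurable_coe _ fun A hA => by
    simpa only [sizes_apply _ hA] using hL.measurable_jumpMeasure_Ioc_prod c d hA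
  have hbind : P.bind sizes = ((d - c : ℝ≥0) : ℝ≥0∞) • ν := by
    ext A hA
    simp only [Measure.bind_apply hA hsizes.aemeasurable, sizes_apply _ hA,
      hL.jump_intensity c d hcd A hA, Measure.smul_apply, smul_eq_mul]
  rw [← smul_eq_mul, ← lintegral_smul_measure, ← hbind,
    Measure.lintegral_bind hsizes.aemeasurable hg.aemeasurable]
  simp only [sizes, lintegral_map hg measurable_snd]

lemma lintegral_sub (hL : IsIncreasingPureJumpLevy L ν P) {c d : ℝ≥0} (hcd : c ≤ d) :
    ∫⁻ ω, ENNReal.ofReal (L d ω - L c ω) ∂P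
      = ((d - c : ℝ≥0) : ℝ≥0∞) * ∫⁻ z, ENNReal.ofReal z ∂ν := by
  simp only [← hL.lintegral_lintegral_jumpMeasure hcd ENNReal.measurable_ofReal,
    setLIntegral_jumpMeasure_ofReal_snd (hL.monotone_paths _) (hL.right_continuous _)
      (hL.pure_jump _)]

lemma pathKernel_comp (hL : IsIncreasingPureJumpLevy L ν P)
    (hν : IntegrableOn (fun z : ℝ => z) (Ioi 0) ν) (a b : ℝ≥0) :
    hL.pathKernel a b ∘ₘ P
      = (∫ z in Ioi 0, z ∂ν).toNNReal • volume.restrict (Ioc (a : ℝ) b) := by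
  have hmean : ∫⁻ z, ENNReal.ofReal z ∂ν = (∫ z in Ioi 0, z ∂ν).toNNReal := by
    rw [ENNReal.ofNNReal_toNNReal, ofReal_integral_eq_lintegral_ofReal hν
      (ae_restrict_of_forall_mem measurableSet_Ioi fun z hz => le_of_lt hz),
      setLIntegral_eq_of_support_subset]
    exact fun z hz => ENNReal.ofReal_pos.1 (pos_iff_ne_zero.2 hz)
  refine (Measure.ext_of_Ioc _ _ fun c d _ => ?_).symm
  rw [Measure.bind_apply measurableSet_Ioc (Kernel.aemeasurable _)]
  simp only [pathKernel_apply, Measure.restrict_apply measurableSet_Ioc, Ioc_inter_Ioc,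
    pathStieltjes_Ioc (hL.monotone_paths _) (hL.right_continuous _), Measure.smul_apply]
  rcases le_total (c ⊔ a) (d ⊓ b) with hle | hle
  · have hc : 0 ≤ c ⊔ a := a.2.trans le_sup_right
    rw [hL.lintegral_sub (Real.toNNReal_mono hle), hmean, Real.volume_Ioc, mul_comm,
      ENNReal.ofReal_sub _ hc, ENNReal.coe_sub]
    rfl
  · have hdecr (ω : Ω) : L (d ⊓ b).toNNReal ω - L (c ⊔ a).toNNReal ω ≤ 0 :=
      sub_nonpos.2 (hL.monotone_paths ω (Real.toNNReal_mono hle))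
    simp only [Ioc_eq_empty_of_le hle, measure_empty, smul_zero, ENNReal.ofReal_of_nonpos (hdecr _),
      lintegral_zero]

lemma integrable_pathKernel_comp (hL : IsIncreasingPureJumpLevy L ν P)
    (hν : IntegrableOn (fun z : ℝ => z) (Ioi 0) ν) {a b : ℝ≥0} {h : ℝ → ℝ}
    (hh : IntegrableOn h (Ioc a b)) : Integrable h (hL.pathKernel a b ∘ₘ P) := by
  rw [hL.pathKernel_comp hν]
  exact Integrable.smul_measure_nnreal hh

lemma ae_integrableOn_pathStieltjes (hL : IsIncreasingPureJumpLevy L ν P)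
    (hν : IntegrableOn (fun z : ℝ => z) (Ioi 0) ν) {a b : ℝ≥0} {h : ℝ → ℝ}
    (hh : IntegrableOn h (Ioc a b)) :
    ∀ᵐ ω ∂P, IntegrableOn h (Ioc a b) (pathStieltjes fun r => L r ω) :=
  Measure.ae_integrable_of_integrable_comp (κ := hL.pathKernel a b) <|
    hL.integrable_pathKernel_comp hν hh

lemma integrable_setIntegral_pathStieltjes (hL : IsIncreasingPureJumpLevy L ν P)
    (hν : IntegrableOn (fun z : ℝ => z) (Ioi 0) ν) {a b : ℝ≥0} {h : ℝ → ℝ}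
    (hh : IntegrableOn h (Ioc a b)) :
    Integrable (fun ω => ∫ s in Ioc (a : ℝ) b, h s ∂(pathStieltjes fun r => L r ω)) P := by
  have hcomp := hL.integrable_pathKernel_comp hν hh
  rw [Measure.comp_eq_comp_const_apply] at hcomp
  simpa [pathKernel_apply] using hcomp.integral_comp

lemma integral_setIntegral_pathStieltjes (hL : IsIncreasingPureJumpLevy L ν P)
    (hν : IntegrableOn (fun z : ℝ => z) (Ioi 0) ν) {a b : ℝ≥0} {h : ℝ → ℝ}
    (hh : IntegrableOn h (Ioc a b)) :
    ∫ ω, ∫ s in Ioc (a : ℝ) b, h s ∂(pathStieltjes fun r => L r ω) ∂P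
      = (∫ z in Ioi 0, z ∂ν) * ∫ s in Ioc (a : ℝ) b, h s := by
  have hcomp := hL.integrable_pathKernel_comp hν hh
  have hm : 0 ≤ ∫ z in Ioi 0, z ∂ν := setIntegral_nonneg measurableSet_Ioi fun z hz => le_of_lt hz
  rw [Measure.comp_eq_comp_const_apply] at hcomp
  have hfubini := Kernel.integral_comp hcomp
  rw [← Measure.comp_eq_comp_const_apply, hL.pathKernel_comp hν, integral_smul_nnreal_measure,
    Kernel.const_apply] at hfubini
  rw [← Real.coe_toNNReal _ hm]
  exact hfubini.symm

lemma aestronglyMeasurable_setIntegral_pathStieltjes (hL : IsIncreasingPureJumpLevy L ν P)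
    (hν : IntegrableOn (fun z : ℝ => z) (Ioi 0) ν) {a b : ℝ≥0} {h : ℝ → ℝ}
    (hh : IntegrableOn h (Ioc a b)) {m : MeasurableSpace Ω}
    (hm : ∀ c d, a ≤ c → c ≤ d → d ≤ b → Measurable[m] fun ω => L d ω - L c ω) :
    AEStronglyMeasurable[m]
      (fun ω => ∫ s in Ioc (a : ℝ) b, h s ∂(pathStieltjes fun r => L r ω)) P := by
  let κ : Kernel[m] Ω ℝ :=
    ⟨_, measurable_pathStieltjes_restrict hL.monotone_paths hL.right_continuous hm⟩
  have hmk : ∀ᵐ ω ∂P, h =ᵐ[hL.pathKernel a b ω] hh.aestronglyMeasurable.mk h := by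
    refine Measure.ae_ae_of_ae_comp ?_
    rw [hL.pathKernel_comp hν]
    exact Measure.ae_smul_measure hh.aestronglyMeasurable.ae_eq_mk _
  exact ⟨_, hh.aestronglyMeasurable.stronglyMeasurable_mk.integral_kernel (κ := κ),
    hmk.mono fun ω hω => integral_congr_ae hω⟩

end IsIncreasingPureJumpLevy

section Fubini

variable {μ : Measure ℝ} {g k : ℝ → ℝ} {t a b : ℝ}

lemma integrable_indicator_le_mul [SFinite μ] (hg : IntegrableOn g (Ioc a b))
    (hk : IntegrableOn k (Ioc t b) μ) :
    Integrable ({p : ℝ × ℝ | p.2 ≤ p.1}.indicator fun p => g p.1 * k p.2)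
      ((volume.restrict (Ioc a b)).prod (μ.restrict (Ioc t b))) :=
  (hg.mul_prod hk).indicator (measurableSet_le measurable_snd measurable_fst)

lemma setIntegral_indicator_le_mul_right {u : ℝ} (hu : u ≤ b) :
    ∫ s in Ioc t b, {p : ℝ × ℝ | p.2 ≤ p.1}.indicator (fun p => g p.1 * k p.2) (u, s) ∂μ
      = g u * ∫ s in Ioc t u, k s ∂μ := by
  have hsection (s : ℝ) : {p : ℝ × ℝ | p.2 ≤ p.1}.indicator (fun p => g p.1 * k p.2) (u, s)
      = (Iic u).indicator (fun s => g u * k s) s := by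
    simp only [indicator, mem_ofPred_eq, mem_Iic]
  simp only [hsection, setIntegral_indicator measurableSet_Iic, Ioc_inter_Iic, inf_eq_right.2 hu,
    integral_const_mul]

lemma setIntegral_indicator_le_mul_left {s : ℝ} (hab : a ≤ b) (hs : s ≤ b) :
    ∫ u in Ioc a b, {p : ℝ × ℝ | p.2 ≤ p.1}.indicator (fun p => g p.1 * k p.2) (u, s)
      = k s * ∫ u in (a ⊔ s)..b, g u := by
  have hsection (u : ℝ) : {p : ℝ × ℝ | p.2 ≤ p.1}.indicator (fun p => g p.1 * k p.2) (u, s)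
      = (Ici s).indicator (fun u => k s * g u) u := by
    simp only [indicator, mem_ofPred_eq, mem_Ici, mul_comm]
  have hae : (Ioc a b ∩ Ici s : Set ℝ) =ᵐ[volume] Ioc (a ⊔ s) b := by
    rw [← Ioc_inter_Ioi]
    exact (ae_eq_refl _).inter Ioi_ae_eq_Ici.symm
  simp only [hsection, setIntegral_indicator measurableSet_Ici, integral_const_mul,
    setIntegral_congr_set hae, intervalIntegral.integral_of_le (sup_le hab hs)]

lemma integrableOn_mul_intervalIntegral_sup [SFinite μ] (hab : a ≤ b)
    (hg : IntervalIntegrable g volume a b)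
    (hk : IntegrableOn k (Ioc t b) μ) :
    IntegrableOn (fun s => k s * ∫ u in (a ⊔ s)..b, g u) (Ioc t b) μ :=
  (integrable_indicator_le_mul hg.1 hk).integral_prod_right.congr <|
    ae_restrict_of_forall_mem measurableSet_Ioc fun _ hs =>
      setIntegral_indicator_le_mul_left hab hs.2

lemma intervalIntegrable_mul_setIntegral_Ioc [SFinite μ] (hab : a ≤ b)
    (hg : IntervalIntegrable g volume a b)
    (hk : IntegrableOn k (Ioc t b) μ) :
    IntervalIntegrable (fun u => g u * ∫ s in Ioc t u, k s ∂μ) volume a b :=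
  (intervalIntegrable_iff_integrableOn_Ioc_of_le hab).2 <|
    (integrable_indicator_le_mul hg.1 hk).integral_prod_left.congr <|
      ae_restrict_of_forall_mem measurableSet_Ioc fun _ hu =>
        setIntegral_indicator_le_mul_right hu.2

lemma integral_mul_setIntegral_Ioc [SFinite μ] (hab : a ≤ b)
    (hg : IntervalIntegrable g volume a b) (hk : IntegrableOn k (Ioc t b) μ) :
    ∫ u in a..b, g u * ∫ s in Ioc t u, k s ∂μ
      = ∫ s in Ioc t b, k s * (∫ u in (a ⊔ s)..b, g u) ∂μ := by
  have hswap := integral_integral_swap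
    (f := fun u s => {p : ℝ × ℝ | p.2 ≤ p.1}.indicator (fun p => g p.1 * k p.2) (u, s))
    (integrable_indicator_le_mul hg.1 hk)
  rwa [setIntegral_congr_fun measurableSet_Ioc fun u hu => setIntegral_indicator_le_mul_right hu.2,
    setIntegral_congr_fun measurableSet_Ioc fun s hs => setIntegral_indicator_le_mul_left hab hs.2,
    ← intervalIntegral.integral_of_le hab] at hswap

end Fubini

section OrnsteinUhlenbeckPath

variable {μ : Measure ℝ} {k : ℝ → ℝ} {a b : ℝ}

lemma integrableOn_exp_mul (hk : IntegrableOn k (Ioc a b) μ) (lam : ℝ) :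
    IntegrableOn (fun s => Real.exp (lam * s) * k s) (Ioc a b) μ := by
  have hcont : Continuous fun s => Real.exp (lam * s) := by fun_prop
  obtain ⟨C, hC⟩ := isCompact_Icc.exists_bound_of_continuousOn (hcont.continuousOn (s := Icc a b))
  exact hk.bdd_mul hcont.aestronglyMeasurable <| ae_restrict_of_forall_mem measurableSet_Ioc
    fun s hs => hC s (Ioc_subset_Icc_self hs)

lemma integral_mul_exp_mul (lam a b : ℝ) :
    ∫ u in a..b, lam * Real.exp (lam * u) = Real.exp (lam * b) - Real.exp (lam * a) :=
  intervalIntegral.integral_eq_sub_of_hasDerivAt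
    (fun u _ => by simpa [mul_comm] using ((hasDerivAt_id u).const_mul lam).exp)
    (Continuous.intervalIntegrable (by fun_prop) _ _)

lemma integral_exp_mul_setIntegral_Ioc [SFinite μ] (hab : a ≤ b)
    (hk : IntegrableOn k (Ioc a b) μ) (lam : ℝ) :
    ∫ u in a..b, lam * Real.exp (lam * u) * ∫ s in Ioc a u, k s ∂μ
      = Real.exp (lam * b) * (∫ s in Ioc a b, k s ∂μ)
        - ∫ s in Ioc a b, Real.exp (lam * s) * k s ∂μ := by
  rw [integral_mul_setIntegral_Ioc hab (Continuous.intervalIntegrable (by fun_prop) _ _) hk,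
    ← integral_const_mul, ← integral_sub (hk.const_mul _) (integrableOn_exp_mul hk lam)]
  refine setIntegral_congr_fun measurableSet_Ioc fun s hs => ?_
  simp only [sup_eq_right.2 hs.1.le, integral_mul_exp_mul]
  ring

/-- A single path `v` of an Ornstein–Uhlenbeck process: the solution on `[0, T]` of
`dv = -lam v dt + σ dμ`, `v(0) = y`, for a fixed driving measure `μ`. -/
structure IsOUPath (T lam y : ℝ) (σ : ℝ → ℝ) (μ : Measure ℝ) (v : ℝ → ℝ) : Prop where
  intervalIntegrable : IntervalIntegrable v volume 0 T
  integrableOn : IntegrableOn σ (Ioc 0 T) μ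
  eq : ∀ t ∈ Icc 0 T, v t = y - (∫ s in 0..t, lam * v s) + ∫ s in Ioc 0 t, σ s ∂μ

/-- The total weight in `∫ₐᵇ Λ(u) Y(u) du` of the noise `dL(s)`: at time `s` it enters `Y` with the
factor `σ(s)`, and then decays at rate `lam`. -/
noncomputable def noiseLoading (lam : ℝ) (σ Λ : ℝ → ℝ) (a b s : ℝ) : ℝ :=
  Real.exp (lam * s) * σ s * ∫ u in (a ⊔ s)..b, Λ u * Real.exp (-lam * u)

lemma integrableOn_noiseLoading [SFinite μ] {lam t : ℝ} {σ Λ : ℝ → ℝ} (hab : a ≤ b)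
    (hσ : IntegrableOn σ (Ioc t b) μ) (hΛ : IntervalIntegrable Λ volume a b) :
    IntegrableOn (noiseLoading lam σ Λ a b) (Ioc t b) μ :=
  integrableOn_mul_intervalIntegral_sup hab (hΛ.mul_continuousOn (by fun_prop))
    (integrableOn_exp_mul hσ lam)

lemma setIntegral_noiseLoading [SFinite μ] {lam t : ℝ} {σ Λ : ℝ → ℝ} (hab : a ≤ b)
    (hσ : IntegrableOn σ (Ioc t b) μ) (hΛ : IntervalIntegrable Λ volume a b) :
    ∫ s in Ioc t b, noiseLoading lam σ Λ a b s ∂μ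
      = ∫ u in a..b, Λ u * Real.exp (-lam * u)
          * ∫ s in Ioc t u, Real.exp (lam * s) * σ s ∂μ :=
  (integral_mul_setIntegral_Ioc hab (hΛ.mul_continuousOn (by fun_prop))
    (integrableOn_exp_mul hσ lam)).symm

namespace IsOUPath

variable {T lam y : ℝ} {σ v Λ : ℝ → ℝ}

-- With integrating factor `e^{lam t}`, Fubini plays the part of the product rule.
lemma exp_mul_eq [SFinite μ] (hv : IsOUPath T lam y σ μ v) {t : ℝ} (ht : t ∈ Icc 0 T) :
    Real.exp (lam * t) * v t = y + ∫ s in Ioc 0 t, Real.exp (lam * s) * σ s ∂μ := by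
  have hvt : IntegrableOn (fun s => lam * v s) (Ioc 0 t) :=
    (hv.intervalIntegrable.1.mono_set (Ioc_subset_Ioc_right ht.2)).const_mul lam
  have hσt : IntegrableOn σ (Ioc 0 t) μ := hv.integrableOn.mono_set (Ioc_subset_Ioc_right ht.2)
  have hexp : IntervalIntegrable (fun u => lam * Real.exp (lam * u)) volume 0 t :=
    Continuous.intervalIntegrable (by fun_prop) _ _
  have hpath : ∫ u in 0..t, lam * Real.exp (lam * u) * v u
      = ∫ u in 0..t, (y * (lam * Real.exp (lam * u))
          - lam * Real.exp (lam * u) * ∫ s in Ioc 0 u, lam * v s)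
          + lam * Real.exp (lam * u) * ∫ s in Ioc 0 u, σ s ∂μ := by
    refine intervalIntegral.integral_congr fun u hu => ?_
    rw [uIcc_of_le ht.1] at hu
    simp only [hv.eq u ⟨hu.1, hu.2.trans ht.2⟩, intervalIntegral.integral_of_le hu.1]
    ring
  rw [intervalIntegral.integral_add
      ((hexp.const_mul y).sub (intervalIntegrable_mul_setIntegral_Ioc ht.1 hexp hvt))
      (intervalIntegrable_mul_setIntegral_Ioc ht.1 hexp hσt),
    intervalIntegral.integral_sub (hexp.const_mul y)
      (intervalIntegrable_mul_setIntegral_Ioc ht.1 hexp hvt),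
    intervalIntegral.integral_const_mul, integral_mul_exp_mul,
    integral_exp_mul_setIntegral_Ioc ht.1 hvt, integral_exp_mul_setIntegral_Ioc ht.1 hσt,
    ← intervalIntegral.integral_of_le ht.1, ← intervalIntegral.integral_of_le ht.1] at hpath
  have hcomm : ∫ u in 0..t, lam * Real.exp (lam * u) * v u
      = ∫ u in 0..t, Real.exp (lam * u) * (lam * v u) := by
    simp only [mul_left_comm, mul_assoc]
  rw [hcomm, mul_zero, Real.exp_zero] at hpath
  rw [hv.eq t ht]
  linear_combination -hpath

lemma exp_mul_eq_restart [SFinite μ] (hv : IsOUPath T lam y σ μ v) {t u : ℝ} (ht : 0 ≤ t)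
    (htu : t ≤ u) (hu : u ≤ T) :
    Real.exp (lam * u) * v u
      = Real.exp (lam * t) * v t + ∫ s in Ioc t u, Real.exp (lam * s) * σ s ∂μ := by
  have hint := integrableOn_exp_mul hv.integrableOn lam
  rw [hv.exp_mul_eq ⟨ht.trans htu, hu⟩, hv.exp_mul_eq ⟨ht, htu.trans hu⟩,
    ← Ioc_union_Ioc_eq_Ioc ht htu,
    setIntegral_union (Ioc_disjoint_Ioc_of_le le_rfl) measurableSet_Ioc
      (hint.mono_set (Ioc_subset_Ioc_right (htu.trans hu)))
      (hint.mono_set (Ioc_subset_Ioc ht hu)), add_assoc]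

lemma mul_eq [SFinite μ] (hv : IsOUPath T lam y σ μ v) (Λ : ℝ → ℝ) {t u : ℝ} (ht : 0 ≤ t)
    (htu : t ≤ u) (hu : u ≤ T) :
    Λ u * v u = v t * (Λ u * Real.exp (-lam * (u - t)))
      + Λ u * Real.exp (-lam * u) * ∫ s in Ioc t u, Real.exp (lam * s) * σ s ∂μ := by
  have hsplit : Real.exp (-lam * (u - t)) = Real.exp (-lam * u) * Real.exp (lam * t) := by
    rw [← Real.exp_add]; ring_nf
  have hcancel : Real.exp (-lam * u) * Real.exp (lam * u) = 1 := by
    rw [← Real.exp_add]; simp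
  linear_combination (Λ u * Real.exp (-lam * u)) * hv.exp_mul_eq_restart ht htu hu
    - Λ u * v u * hcancel - v t * Λ u * hsplit

lemma intervalIntegrable_mul [SFinite μ] (hv : IsOUPath T lam y σ μ v) (ha : 0 ≤ a) (hab : a ≤ b)
    (hb : b ≤ T) (hΛ : IntervalIntegrable Λ volume a b) :
    IntervalIntegrable (fun u => Λ u * v u) volume a b := by
  have hσ := integrableOn_exp_mul (hv.integrableOn.mono_set (Ioc_subset_Ioc ha hb)) lam
  have hΛexp : IntervalIntegrable (fun u => Λ u * Real.exp (-lam * u)) volume a b :=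
    hΛ.mul_continuousOn (by fun_prop)
  have hdecay : IntervalIntegrable (fun u => Λ u * Real.exp (-lam * (u - a))) volume a b :=
    hΛ.mul_continuousOn (by fun_prop)
  refine ((hdecay.const_mul (v a)).add
    (intervalIntegrable_mul_setIntegral_Ioc hab hΛexp hσ)).congr fun u hu => ?_
  rw [uIoc_of_le hab] at hu
  exact (hv.mul_eq Λ ha hu.1.le (hu.2.trans hb)).symm

lemma integral_mul [SFinite μ] (hv : IsOUPath T lam y σ μ v) {t : ℝ} (ht : 0 ≤ t) (hta : t ≤ a)
    (hab : a ≤ b) (hb : b ≤ T) (hΛ : IntervalIntegrable Λ volume a b) :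
    ∫ u in a..b, Λ u * v u
      = v t * (∫ u in a..b, Λ u * Real.exp (-lam * (u - t)))
        + ∫ s in Ioc t b, noiseLoading lam σ Λ a b s ∂μ := by
  have hσ := hv.integrableOn.mono_set (Ioc_subset_Ioc ht hb)
  have hΛexp : IntervalIntegrable (fun u => Λ u * Real.exp (-lam * u)) volume a b :=
    hΛ.mul_continuousOn (by fun_prop)
  have hdecay : IntervalIntegrable (fun u => Λ u * Real.exp (-lam * (u - t))) volume a b :=
    hΛ.mul_continuousOn (by fun_prop)
  rw [setIntegral_noiseLoading hab hσ hΛ, ← intervalIntegral.integral_const_mul,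
    ← intervalIntegral.integral_add (hdecay.const_mul (v t))
      (intervalIntegrable_mul_setIntegral_Ioc hab hΛexp (integrableOn_exp_mul hσ lam))]
  refine intervalIntegral.integral_congr fun u hu => ?_
  rw [uIcc_of_le hab] at hu
  exact hv.mul_eq Λ ht (hta.trans hu.1) (hu.2.trans hb)

end IsOUPath

end OrnsteinUhlenbeckPath

section FiniteSubset

variable {S : Type*} [LinearOrder S] [OrderBot S]

lemma exists_monotone_seq_finset_subset_range (F : Finset S) :
    ∃ τ : ℕ → S, Monotone τ ∧ τ 0 = ⊥ ∧ ∀ s ∈ F, ∃ k, τ k = s := by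
  obtain ⟨n, hn⟩ : ∃ n, (insert ⊥ F).card = n + 1 :=
    Nat.exists_eq_add_one.2 (Finset.card_pos.2 ⟨⊥, Finset.mem_insert_self _ _⟩)
  let e := (insert ⊥ F).orderEmbOfFin hn
  have hrange {s : S} (hs : s ∈ insert ⊥ F) : ∃ k : ℕ, e (Fin.clamp k n) = s := by
    obtain ⟨k, rfl⟩ : s ∈ range e := by rwa [Finset.range_orderEmbOfFin]
    exact ⟨k, congrArg e (Fin.ext (min_eq_left (Nat.le_of_lt_succ k.2)))⟩
  have hmono : Monotone fun k => e (Fin.clamp k n) :=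
    fun j k hjk => e.monotone (Fin.mk_le_mk.2 (min_le_min_right n hjk))
  refine ⟨fun k => e (Fin.clamp k n), hmono, ?_, fun s hs => hrange (Finset.mem_insert_of_mem hs)⟩
  obtain ⟨k, hk⟩ := hrange (Finset.mem_insert_self ⊥ F)
  exact le_bot_iff.1 (hk ▸ hmono (Nat.zero_le k))

end FiniteSubset

section IndependentIncrements

variable {ι S E Ω : Type*} {mΩ : MeasurableSpace Ω} {P : Measure Ω} [AddCommGroup E]
  [MeasurableSpace E] [MeasurableSub₂ E]

lemma indepFun_past_future_nat [MeasurableAdd₂ E] {W : ι → ℕ → Ω → E}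
    (hmeas : ∀ i j, Measurable (W i j)) (h0 : ∀ i ω, W i 0 ω = 0)
    (hind : iIndepFun (fun (p : ι × ℕ) ω => W p.1 (p.2 + 1) ω - W p.1 p.2 ω) P) (k : ℕ) :
    IndepFun (fun ω (j : Iic k) i => W i j ω) (fun ω (j : Ici k) i => W i j ω - W i k ω) P := by
  let step (p : ι × ℕ) (ω : Ω) : E := W p.1 (p.2 + 1) ω - W p.1 p.2 ω
  have hsplit := indep_iSup_of_disjoint (S := {p : ι × ℕ | p.2 < k}) (T := {p | k ≤ p.2})
    (fun p => ((hmeas p.1 _).sub (hmeas p.1 _)).comap_le) hind.iIndep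
    (disjoint_left.2 fun p => by simp)
  let gen (A : Set (ι × ℕ)) : MeasurableSpace Ω :=
    ⨆ p ∈ A, MeasurableSpace.comap (step p) inferInstance
  have hstep {A : Set (ι × ℕ)} {p : ι × ℕ} (hp : p ∈ A) : Measurable[gen A] (step p) :=
    (comap_measurable (step p)).mono
      (le_iSup₂ (f := fun p (_ : p ∈ A) => MeasurableSpace.comap (step p) inferInstance) p hp)
      le_rfl
  have hpast (j : Iic k) (i : ι) : Measurable[gen {p | p.2 < k}] fun ω => W i j ω := by
    have hsum (ω : Ω) : W i j ω = ∑ l ∈ Finset.range j, step (i, l) ω := by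
      rw [Finset.sum_range_sub (fun l => W i l ω), h0, sub_zero]
    simp only [hsum]
    exact Finset.measurable_fun_sum _ fun l hl => hstep ((Finset.mem_range.1 hl).trans_le j.2)
  have hfuture (j : Ici k) (i : ι) :
      Measurable[gen {p | k ≤ p.2}] fun ω => W i j ω - W i k ω := by
    have hsum (ω : Ω) : W i j ω - W i k ω = ∑ l ∈ Finset.Ico k j, step (i, l) ω := by
      rw [Finset.sum_Ico_sub (fun l => W i l ω) j.2]
    simp only [hsum]
    exact Finset.measurable_fun_sum _ fun l hl => hstep (Finset.mem_Ico.1 hl).1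
  refine indep_of_indep_of_le hsplit ?_ ?_ <;>
    simp only [MeasurableSpace.comap_process_pi, iSup_le_iff] <;> intro j i
  · exact (hpast j i).comap_le
  · exact (hfuture j i).comap_le

variable {X : ι → S → Ω → E}

lemma iIndepFun_increments [Preorder S] (hmeas : ∀ i t, Measurable (X i t))
    (hincr : ∀ i, HasIndepIncrements (X i) P) (hind : iIndepFun (fun i ω t => X i t ω) P)
    {τ : ℕ → S} (hτ : Monotone τ) :
    iIndepFun (fun (p : ι × ℕ) ω => X p.1 (τ (p.2 + 1)) ω - X p.1 (τ p.2) ω) P :=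
  iIndepFun_uncurry' (X := fun i j ω => X i (τ (j + 1)) ω - X i (τ j) ω)
    (fun i j => (hmeas i _).sub (hmeas i _))
    (hind.comp (fun _ x j => x (τ (j + 1)) - x (τ j)) fun _ => by fun_prop)
    fun i => (hincr i).nat hτ

lemma indepFun_past_future [LinearOrder S] [OrderBot S] [MeasurableAdd₂ E]
    [IsZeroOrProbabilityMeasure P] (hmeas : ∀ i t, Measurable (X i t))
    (h0 : ∀ i ω, X i ⊥ ω = 0) (hincr : ∀ i, HasIndepIncrements (X i) P)
    (hind : iIndepFun (fun i ω t => X i t ω) P) (t : S) :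
    IndepFun (fun ω (s : Iic t) i => X i s ω) (fun ω (s : Ici t) i => X i s ω - X i t ω) P := by
  refine IndepFun.process_indepFun_process (fun s => measurable_pi_lambda _ fun i => hmeas i s)
    (fun s => measurable_pi_lambda _ fun i => (hmeas i s).sub (hmeas i t)) fun I J => ?_
  obtain ⟨τ, hτ, hτ0, hτF⟩ := exists_monotone_seq_finset_subset_range
    (insert t (I.image Subtype.val ∪ J.image Subtype.val))
  obtain ⟨k, rfl⟩ := hτF t (Finset.mem_insert_self _ _)
  have hpast (s : I) : ∃ j : Iic k, τ j = s.1 := by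
    obtain ⟨j, hj⟩ := hτF s.1 (by grind)
    exact ⟨⟨min j k, mem_Iic.2 (min_le_right _ _)⟩, by rw [hτ.map_min, hj, min_eq_left s.1.2]⟩
  have hfuture (s : J) : ∃ j : Ici k, τ j = s.1 := by
    obtain ⟨j, hj⟩ := hτF s.1 (by grind)
    exact ⟨⟨max j k, mem_Ici.2 (le_max_right _ _)⟩, by rw [hτ.map_max, hj, max_eq_left s.1.2]⟩
  choose p hp using hpast
  choose q hq using hfuture
  simp only [← hp, ← hq]
  exact (indepFun_past_future_nat (fun i j => hmeas i (τ j)) (fun i ω => by rw [hτ0, h0])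
    (iIndepFun_increments hmeas hincr hind hτ) k).comp
    (φ := fun x s => x (p s)) (ψ := fun x s => x (q s)) (by fun_prop) (by fun_prop)

end IndependentIncrements

section GeneratedFiltration

variable {Ω : Type*} {mΩ : MeasurableSpace Ω} {P : Measure Ω} {n : ℕ} {L : Fin n → ℝ≥0 → Ω → ℝ}

lemma measurable_generatedFiltration (hmeas : ∀ i t, Measurable (L i t)) (i : Fin n) {s t : ℝ≥0}
    (hst : s ≤ t) : Measurable[generatedFiltration L hmeas t] (L i s) :=
  (measurable_pi_apply i).comp <| (comap_measurable fun ω j => L j s ω).mono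
    (le_iSup₂ (f := fun s (_ : s ≤ t) => MeasurableSpace.comap (fun ω j => L j s ω) inferInstance)
      s hst) le_rfl

/-- The σ-algebra generated by the increments of `L 0, …, L (n-1)` after time `t`. -/
@[reducible] noncomputable def futureIncrements (L : Fin n → ℝ≥0 → Ω → ℝ) (t : ℝ≥0) :
    MeasurableSpace Ω :=
  MeasurableSpace.comap (fun ω (s : Ici t) i => L i s ω - L i t ω) inferInstance

lemma futureIncrements_le (hmeas : ∀ i t, Measurable (L i t)) (t : ℝ≥0) :
    futureIncrements L t ≤ mΩ :=
  Measurable.comap_le <| by fun_prop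

lemma measurable_futureIncrements (i : Fin n) {t c d : ℝ≥0} (hc : t ≤ c) (hd : t ≤ d) :
    Measurable[futureIncrements L t] fun ω => L i d ω - L i c ω := by
  have hincr {s : ℝ≥0} (hs : t ≤ s) :
      Measurable[futureIncrements L t] fun ω => L i s ω - L i t ω :=
    (measurable_pi_apply i).comp <| (measurable_pi_apply (⟨s, hs⟩ : Ici t)).comp <|
      comap_measurable fun ω (s : Ici t) i => L i s ω - L i t ω
  simpa using (hincr hd).fun_sub (hincr hc)

lemma indep_futureIncrements_generatedFiltration [IsZeroOrProbabilityMeasure P]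
    (hmeas : ∀ i t, Measurable (L i t)) (h0 : ∀ i ω, L i 0 ω = 0)
    (hincr : ∀ i, HasIndepIncrements (L i) P) (hind : iIndepFun (fun i ω t => L i t ω) P)
    (t : ℝ≥0) : Indep (futureIncrements L t) (generatedFiltration L hmeas t) P := by
  rw [generatedFiltration, Filtration.natural_eq_comap]
  exact (indepFun_past_future hmeas h0 hincr hind t).symm

end GeneratedFiltration

section ConditionalExpectation

variable {Ω : Type*} {m m' mΩ : MeasurableSpace Ω} {P : Measure Ω}

lemma aestronglyMeasurable_fun_sum {ι : Type*} (s : Finset ι) {f : ι → Ω → ℝ}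
    (hf : ∀ i ∈ s, AEStronglyMeasurable[m] (f i) P) :
    AEStronglyMeasurable[m] (fun ω => ∑ i ∈ s, f i ω) P := by
  have hsum := Finset.sum_induction f (AEStronglyMeasurable[m] · P) (fun _ _ hg hk => hg.add hk)
    aestronglyMeasurable_const hf
  rwa [Finset.sum_fn] at hsum

lemma condExp_add_of_indep (hm : m ≤ mΩ) (hm' : m' ≤ mΩ) [SigmaFinite (P.trim hm)]
    (hind : Indep m' m P) {A R : Ω → ℝ} (hA : AEStronglyMeasurable[m] A P) (hAi : Integrable A P)
    (hR : AEStronglyMeasurable[m'] R P) (hRi : Integrable R P) :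
    P[A + R | m] =ᵐ[P] fun ω => A ω + ∫ ω', R ω' ∂P := by
  have hRm : P[R | m] =ᵐ[P] fun _ => ∫ ω', R ω' ∂P := by
    rw [integral_congr_ae hR.ae_eq_mk]
    exact (condExp_congr_ae hR.ae_eq_mk).trans <|
      condExp_indep_eq hm' hm hR.stronglyMeasurable_mk hind
  exact (condExp_add hAi hRi m).trans <|
    (condExp_of_aestronglyMeasurable' hm hA hAi).add hRm

end ConditionalExpectation

namespace IsIncreasingPureJumpLevy

variable {Ω : Type*} {mΩ : MeasurableSpace Ω} {P : Measure Ω} {L : ℝ≥0 → Ω → ℝ} {ν : Measure ℝ}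

lemma integral_setIntegral_noiseLoading (hL : IsIncreasingPureJumpLevy L ν P)
    (hν : IntegrableOn (fun z : ℝ => z) (Ioi 0) ν) {t a b : ℝ≥0} (hta : t ≤ a) (hab : a ≤ b)
    (lam : ℝ) {σ Λ : ℝ → ℝ} (hσ : IntegrableOn σ (Ioc t b))
    (hΛ : IntervalIntegrable Λ volume a b) :
    ∫ ω, ∫ s in Ioc (t : ℝ) b, noiseLoading lam σ Λ a b s ∂(pathStieltjes fun r => L r ω) ∂P
      = ∫ u in (a : ℝ)..b, ∫ s in (t : ℝ)..u, ∫ z in Ioi (0 : ℝ),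
          σ s * Λ u * Real.exp (-lam * (u - s)) * z ∂ν := by
  have hab' : (a : ℝ) ≤ b := NNReal.coe_le_coe.2 hab
  rw [hL.integral_setIntegral_pathStieltjes hν (integrableOn_noiseLoading hab' hσ hΛ),
    setIntegral_noiseLoading hab' hσ hΛ, ← intervalIntegral.integral_const_mul]
  refine intervalIntegral.integral_congr fun u hu => ?_
  rw [uIcc_of_le hab'] at hu
  have htu : (t : ℝ) ≤ u := (NNReal.coe_le_coe.2 hta).trans hu.1
  simp only [← intervalIntegral.integral_of_le htu, ← intervalIntegral.integral_const_mul]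
  refine intervalIntegral.integral_congr fun s _ => ?_
  have hexp : Real.exp (-lam * (u - s)) = Real.exp (-lam * u) * Real.exp (lam * s) := by
    rw [← Real.exp_add]; ring_nf
  simp only [hexp]
  rw [integral_const_mul]
  ring

end IsIncreasingPureJumpLevy

/-- `Y` is an Ornstein–Uhlenbeck process on `[0, T]` driven by the increasing pure jump Lévy process
`L`, with the two integrability conditions which make the stochastic integral `∫ σ dL` have a
finite expectation. -/
structure IsIntegrableLevyOU {Ω : Type*} {mΩ : MeasurableSpace Ω} (T : ℝ≥0) (lam y : ℝ)
    (σ : ℝ → ℝ) (ν : Measure ℝ) (L Y : ℝ≥0 → Ω → ℝ) (P : Measure Ω) : Prop where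
  levy : IsIncreasingPureJumpLevy L ν P
  integrableOn_jump : IntegrableOn (fun z : ℝ => z) (Ioi 0) ν
  integrableOn_volatility : IntegrableOn σ (Ioc 0 T)
  solution : IsOUSolution T lam y σ L Y P

namespace IsIntegrableLevyOU

variable {Ω : Type*} {mΩ : MeasurableSpace Ω} {P : Measure Ω} {T : ℝ≥0} {lam y : ℝ} {σ Λ : ℝ → ℝ}
  {ν : Measure ℝ} {L Y : ℝ≥0 → Ω → ℝ} {t a b : ℝ≥0}

lemma integrableOn_volatility_Ioc (h : IsIntegrableLevyOU T lam y σ ν L Y P) (hb : b ≤ T) :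
    IntegrableOn σ (Ioc t b) :=
  h.integrableOn_volatility.mono_set (Ioc_subset_Ioc t.coe_nonneg (NNReal.coe_le_coe.2 hb))

lemma ae_isOUPath (h : IsIntegrableLevyOU T lam y σ ν L Y P) :
    ∀ᵐ ω ∂P, IsOUPath T lam y σ (pathStieltjes fun r => L r ω) fun s => Y s.toNNReal ω := by
  filter_upwards [h.solution, h.levy.ae_integrableOn_pathStieltjes (a := 0) h.integrableOn_jump
    h.integrableOn_volatility] with ω hY hσ
  refine ⟨hY.1, hσ, fun t ht => ?_⟩
  have := hY.2 t.toNNReal (Real.toNNReal_le_iff_le_coe.2 ht.2)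
  rwa [Real.coe_toNNReal t ht.1] at this

lemma ae_eq_exp_mul (h : IsIntegrableLevyOU T lam y σ ν L Y P) (ht : t ≤ T) :
    Y t =ᵐ[P] fun ω => Real.exp (-lam * t) *
      (y + ∫ s in Ioc (0 : ℝ) t, Real.exp (lam * s) * σ s ∂(pathStieltjes fun r => L r ω)) := by
  filter_upwards [h.ae_isOUPath] with ω hω
  have hexp := hω.exp_mul_eq ⟨t.coe_nonneg, NNReal.coe_le_coe.2 ht⟩
  rw [Real.toNNReal_coe] at hexp
  rw [← hexp, ← mul_assoc, ← Real.exp_add, neg_mul, neg_add_cancel, Real.exp_zero, one_mul]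

lemma integrable (h : IsIntegrableLevyOU T lam y σ ν L Y P) [IsFiniteMeasure P] (ht : t ≤ T) :
    Integrable (Y t) P :=
  (((integrable_const y).add (h.levy.integrable_setIntegral_pathStieltjes (a := 0)
    h.integrableOn_jump (integrableOn_exp_mul (h.integrableOn_volatility_Ioc ht) lam))).const_mul
      _).congr (h.ae_eq_exp_mul ht).symm

lemma aestronglyMeasurable (h : IsIntegrableLevyOU T lam y σ ν L Y P) {m : MeasurableSpace Ω}
    (ht : t ≤ T) (hm : ∀ s ≤ t, Measurable[m] (L s)) : AEStronglyMeasurable[m] (Y t) P :=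
  ((aestronglyMeasurable_const.add (h.levy.aestronglyMeasurable_setIntegral_pathStieltjes (a := 0)
    h.integrableOn_jump (integrableOn_exp_mul (h.integrableOn_volatility_Ioc ht) lam)
    fun c d _ hcd hd => (hm d hd).sub (hm c (hcd.trans hd)))).const_mul _).congr
      (h.ae_eq_exp_mul ht).symm

end IsIntegrableLevyOU

section SpotPrice

variable {Ω : Type*} {mΩ : MeasurableSpace Ω} {P : Measure Ω} {n : ℕ} {T : ℝ≥0}
  {Λ σ : Fin n → ℝ → ℝ} {lam y : Fin n → ℝ} {ν : Fin n → Measure ℝ}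
  {L Y : Fin n → ℝ≥0 → Ω → ℝ} {t a b : ℝ≥0}

/-- The best prediction at time `t` of `∫ₐᵇ E(u) du`, up to its deterministic part: every `Y i`
decays from its value at time `t`. -/
noncomputable def decayedSpotIntegral (Λ : Fin n → ℝ → ℝ) (lam : Fin n → ℝ)
    (Y : Fin n → ℝ≥0 → Ω → ℝ) (t a b : ℝ≥0) (ω : Ω) : ℝ :=
  ∑ i, Y i t ω * ∫ u in (a : ℝ)..b, Λ i u * Real.exp (-lam i * (u - t))

/-- The contribution to `∫ₐᵇ E(u) du` of the noise after time `t`. -/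
noncomputable def spotNoise (Λ σ : Fin n → ℝ → ℝ) (lam : Fin n → ℝ) (L : Fin n → ℝ≥0 → Ω → ℝ)
    (t a b : ℝ≥0) (ω : Ω) : ℝ :=
  ∑ i, ∫ s in Ioc (t : ℝ) b, noiseLoading (lam i) (σ i) (Λ i) a b s
    ∂(pathStieltjes fun r => L i r ω)

lemma mul_decayedSpotIntegral (c : ℝ) (ω : Ω) :
    c * decayedSpotIntegral Λ lam Y t a b ω
      = ∑ i, Y i t ω * c * ∫ u in (a : ℝ)..b, Λ i u * Real.exp (-lam i * (u - t)) := by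
  simp only [decayedSpotIntegral, Finset.mul_sum, mul_left_comm, mul_assoc]

lemma ae_intervalIntegrable_spotPrice
    (h : ∀ i, IsIntegrableLevyOU T (lam i) (y i) (σ i) (ν i) (L i) (Y i) P)
    (hab : a ≤ b) (hb : b ≤ T) (hΛ : ∀ i, IntervalIntegrable (Λ i) volume a b) :
    ∀ᵐ ω ∂P, IntervalIntegrable (fun u : ℝ => spotPrice Λ Y u.toNNReal ω) volume a b := by
  filter_upwards [ae_all_iff.2 fun i => (h i).ae_isOUPath] with ω hω
  have hsum := IntervalIntegrable.sum Finset.univ fun i _ =>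
    (hω i).intervalIntegrable_mul a.coe_nonneg (NNReal.coe_le_coe.2 hab) (NNReal.coe_le_coe.2 hb)
      (hΛ i)
  refine hsum.congr fun u hu => ?_
  rw [uIoc_of_le (NNReal.coe_le_coe.2 hab)] at hu
  simp only [spotPrice, Finset.sum_apply, Real.coe_toNNReal u (a.coe_nonneg.trans hu.1.le)]

lemma integral_spotPrice_ae_eq
    (h : ∀ i, IsIntegrableLevyOU T (lam i) (y i) (σ i) (ν i) (L i) (Y i) P)
    (hta : t ≤ a) (hab : a ≤ b) (hb : b ≤ T) (hΛ : ∀ i, IntervalIntegrable (Λ i) volume a b) :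
    (fun ω => ∫ u in (a : ℝ)..b, spotPrice Λ Y u.toNNReal ω)
      =ᵐ[P] decayedSpotIntegral Λ lam Y t a b + spotNoise Λ σ lam L t a b := by
  have hab' : (a : ℝ) ≤ b := NNReal.coe_le_coe.2 hab
  have hb' : (b : ℝ) ≤ T := NNReal.coe_le_coe.2 hb
  filter_upwards [ae_all_iff.2 fun i => (h i).ae_isOUPath] with ω hω
  have hspot : EqOn (fun u : ℝ => spotPrice Λ Y u.toNNReal ω)
      (fun u => ∑ i, Λ i u * Y i u.toNNReal ω) (uIcc a b) := by
    intro u hu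
    rw [uIcc_of_le hab'] at hu
    simp only [spotPrice, Real.coe_toNNReal u (a.coe_nonneg.trans hu.1)]
  rw [intervalIntegral.integral_congr hspot, intervalIntegral.integral_finsetSum
    fun i _ => (hω i).intervalIntegrable_mul a.coe_nonneg hab' hb' (hΛ i), Pi.add_apply,
    decayedSpotIntegral, spotNoise, ← Finset.sum_add_distrib]
  refine Finset.sum_congr rfl fun i _ => ?_
  rw [(hω i).integral_mul t.coe_nonneg (NNReal.coe_le_coe.2 hta) hab' hb' (hΛ i), Real.toNNReal_coe]

lemma integrable_decayedSpotIntegral [IsFiniteMeasure P]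
    (h : ∀ i, IsIntegrableLevyOU T (lam i) (y i) (σ i) (ν i) (L i) (Y i) P) (ht : t ≤ T) :
    Integrable (decayedSpotIntegral Λ lam Y t a b) P :=
  integrable_finsetSum _ fun i _ => ((h i).integrable ht).mul_const _

lemma aestronglyMeasurable_decayedSpotIntegral {m : MeasurableSpace Ω}
    (h : ∀ i, IsIntegrableLevyOU T (lam i) (y i) (σ i) (ν i) (L i) (Y i) P) (ht : t ≤ T)
    (hm : ∀ i, ∀ s ≤ t, Measurable[m] (L i s)) :
    AEStronglyMeasurable[m] (decayedSpotIntegral Λ lam Y t a b) P :=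
  aestronglyMeasurable_fun_sum _ fun i _ =>
    ((h i).aestronglyMeasurable ht (hm i)).mul_const _

lemma integrable_spotNoise
    (h : ∀ i, IsIntegrableLevyOU T (lam i) (y i) (σ i) (ν i) (L i) (Y i) P)
    (hab : a ≤ b) (hb : b ≤ T) (hΛ : ∀ i, IntervalIntegrable (Λ i) volume a b) :
    Integrable (spotNoise Λ σ lam L t a b) P :=
  integrable_finsetSum _ fun i _ =>
    (h i).levy.integrable_setIntegral_pathStieltjes (h i).integrableOn_jump <|
      integrableOn_noiseLoading (NNReal.coe_le_coe.2 hab) ((h i).integrableOn_volatility_Ioc hb)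
        (hΛ i)

lemma aestronglyMeasurable_spotNoise {m : MeasurableSpace Ω}
    (h : ∀ i, IsIntegrableLevyOU T (lam i) (y i) (σ i) (ν i) (L i) (Y i) P)
    (hab : a ≤ b) (hb : b ≤ T) (hΛ : ∀ i, IntervalIntegrable (Λ i) volume a b)
    (hm : ∀ i c d, t ≤ c → c ≤ d → d ≤ b → Measurable[m] fun ω => L i d ω - L i c ω) :
    AEStronglyMeasurable[m] (spotNoise Λ σ lam L t a b) P :=
  aestronglyMeasurable_fun_sum _ fun i _ =>
    (h i).levy.aestronglyMeasurable_setIntegral_pathStieltjes (h i).integrableOn_jump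
      (integrableOn_noiseLoading (NNReal.coe_le_coe.2 hab) ((h i).integrableOn_volatility_Ioc hb)
        (hΛ i)) (hm i)

lemma integral_spotNoise
    (h : ∀ i, IsIntegrableLevyOU T (lam i) (y i) (σ i) (ν i) (L i) (Y i) P)
    (hta : t ≤ a) (hab : a ≤ b) (hb : b ≤ T) (hΛ : ∀ i, IntervalIntegrable (Λ i) volume a b) :
    ∫ ω, spotNoise Λ σ lam L t a b ω ∂P
      = ∑ i, ∫ u in (a : ℝ)..b, ∫ s in (t : ℝ)..u, ∫ z in Ioi (0 : ℝ),
          σ i s * Λ i u * Real.exp (-lam i * (u - s)) * z ∂(ν i) := by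
  have hσ (i : Fin n) : IntegrableOn (σ i) (Ioc t b) := (h i).integrableOn_volatility_Ioc hb
  simp only [spotNoise]
  rw [integral_finsetSum _ fun i _ => (h i).levy.integrable_setIntegral_pathStieltjes
    (h i).integrableOn_jump (integrableOn_noiseLoading (NNReal.coe_le_coe.2 hab) (hσ i) (hΛ i))]
  exact Finset.sum_congr rfl fun i _ => (h i).levy.integral_setIntegral_noiseLoading
    (h i).integrableOn_jump hta hab (lam i) (hσ i) (hΛ i)

lemma integrable_integral_spotPrice [IsFiniteMeasure P]
    (h : ∀ i, IsIntegrableLevyOU T (lam i) (y i) (σ i) (ν i) (L i) (Y i) P)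
    (hab : a ≤ b) (hb : b ≤ T) (hΛ : ∀ i, IntervalIntegrable (Λ i) volume a b) :
    Integrable (fun ω => ∫ u in (a : ℝ)..b, spotPrice Λ Y u.toNNReal ω) P :=
  ((integrable_decayedSpotIntegral h (hab.trans hb)).add (integrable_spotNoise h hab hb hΛ)).congr
    (integral_spotPrice_ae_eq h le_rfl hab hb hΛ).symm

lemma aestronglyMeasurable_integral_spotPrice
    (h : ∀ i, IsIntegrableLevyOU T (lam i) (y i) (σ i) (ν i) (L i) (Y i) P)
    (hab : a ≤ b) (hb : b ≤ T) (hΛ : ∀ i, IntervalIntegrable (Λ i) volume a b) :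
    AEStronglyMeasurable[generatedFiltration L (fun i => (h i).levy.measurable) b]
      (fun ω => ∫ u in (a : ℝ)..b, spotPrice Λ Y u.toNNReal ω) P := by
  have hm (i : Fin n) (s : ℝ≥0) (hs : s ≤ b) :=
    measurable_generatedFiltration (fun i => (h i).levy.measurable) i hs
  exact ((aestronglyMeasurable_decayedSpotIntegral h (hab.trans hb)
      fun i s hs => hm i s (hs.trans hab)).add
    (aestronglyMeasurable_spotNoise h hab hb hΛ fun i c d _ hcd hd =>
      (hm i d hd).sub (hm i c (hcd.trans hd)))).congr
    (integral_spotPrice_ae_eq h le_rfl hab hb hΛ).symm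

lemma condExp_integral_spotPrice [IsProbabilityMeasure P]
    (h : ∀ i, IsIntegrableLevyOU T (lam i) (y i) (σ i) (ν i) (L i) (Y i) P)
    (hind : iIndepFun (fun i ω t => L i t ω) P)
    (hta : t ≤ a) (hab : a ≤ b) (hb : b ≤ T) (hΛ : ∀ i, IntervalIntegrable (Λ i) volume a b) :
    P[fun ω => ∫ u in (a : ℝ)..b, spotPrice Λ Y u.toNNReal ω |
        generatedFiltration L (fun i => (h i).levy.measurable) t]
      =ᵐ[P] fun ω => decayedSpotIntegral Λ lam Y t a b ω
        + ∑ i, ∫ u in (a : ℝ)..b, ∫ s in (t : ℝ)..u, ∫ z in Ioi (0 : ℝ),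
            σ i s * Λ i u * Real.exp (-lam i * (u - s)) * z ∂(ν i) := by
  have hmeas (i : Fin n) := (h i).levy.measurable
  have ht : t ≤ T := hta.trans (hab.trans hb)
  rw [← integral_spotNoise h hta hab hb hΛ]
  refine (condExp_congr_ae (integral_spotPrice_ae_eq h hta hab hb hΛ)).trans <|
    condExp_add_of_indep (Filtration.le _ t) (futureIncrements_le hmeas t)
      (indep_futureIncrements_generatedFiltration hmeas (fun i => (h i).levy.start_zero)
        (fun i => (h i).levy.indep_increments) hind t)
      (aestronglyMeasurable_decayedSpotIntegral h ht fun i _ hs =>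
        measurable_generatedFiltration hmeas i hs)
      (integrable_decayedSpotIntegral h ht)
      (aestronglyMeasurable_spotNoise h hab hb hΛ fun i c d hc hcd _ =>
        measurable_futureIncrements i hc (hc.trans hcd))
      (integrable_spotNoise h hab hb hΛ)

lemma condExp_integral_spotPrice_of_mem [IsProbabilityMeasure P]
    (h : ∀ i, IsIntegrableLevyOU T (lam i) (y i) (σ i) (ν i) (L i) (Y i) P)
    (hind : iIndepFun (fun i ω t => L i t ω) P)
    (hat : a ≤ t) (htb : t ≤ b) (hb : b ≤ T) (hΛ : ∀ i, IntervalIntegrable (Λ i) volume a b) :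
    P[fun ω => ∫ u in (a : ℝ)..b, spotPrice Λ Y u.toNNReal ω |
        generatedFiltration L (fun i => (h i).levy.measurable) t]
      =ᵐ[P] fun ω => (∫ u in (a : ℝ)..t, spotPrice Λ Y u.toNNReal ω)
        + decayedSpotIntegral Λ lam Y t t b ω
        + ∑ i, ∫ u in (t : ℝ)..b, ∫ s in (t : ℝ)..u, ∫ z in Ioi (0 : ℝ),
            σ i s * Λ i u * Real.exp (-lam i * (u - s)) * z ∂(ν i) := by
  have htT : t ≤ T := htb.trans hb
  have ht : (t : ℝ) ∈ uIcc (a : ℝ) b := mem_uIcc_of_le hat htb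
  have hΛat (i : Fin n) : IntervalIntegrable (Λ i) volume a t :=
    (hΛ i).mono_set (uIcc_subset_uIcc_left ht)
  have hΛtb (i : Fin n) : IntervalIntegrable (Λ i) volume t b :=
    (hΛ i).mono_set (uIcc_subset_uIcc_right ht)
  have hpast := integrable_integral_spotPrice h hat htT hΛat
  have hsplit : (fun ω => ∫ u in (a : ℝ)..b, spotPrice Λ Y u.toNNReal ω)
      =ᵐ[P] (fun ω => ∫ u in (a : ℝ)..t, spotPrice Λ Y u.toNNReal ω)
        + fun ω => ∫ u in (t : ℝ)..b, spotPrice Λ Y u.toNNReal ω := by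
    filter_upwards [ae_intervalIntegrable_spotPrice h hat htT hΛat,
      ae_intervalIntegrable_spotPrice h htb hb hΛtb] with ω hω₁ hω₂
    exact (intervalIntegral.integral_add_adjacent_intervals hω₁ hω₂).symm
  filter_upwards [condExp_congr_ae hsplit,
    condExp_add hpast (integrable_integral_spotPrice h htb hb hΛtb) _,
    condExp_of_aestronglyMeasurable' (Filtration.le _ t)
      (aestronglyMeasurable_integral_spotPrice h hat htT hΛat) hpast,
    condExp_integral_spotPrice h hind le_rfl htb hb hΛtb] with ω hsum hadd hknown hfuture
  rw [hsum, hadd, Pi.add_apply, hknown, hfuture, add_assoc]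

lemma futuresPrice_ae_eq (ℱ : Filtration ℝ≥0 mΩ) (E : ℝ≥0 → Ω → ℝ) (T₁ T₂ t : ℝ≥0) :
    futuresPrice P ℱ E T₁ T₂ t =ᵐ[P] fun ω => 1 / ((T₂ : ℝ) - T₁) *
      (P[fun ω => ∫ u in (T₁ : ℝ)..T₂, E u.toNNReal ω | ℱ t]) ω :=
  condExp_smul (1 / ((T₂ : ℝ) - T₁)) (fun ω => ∫ u in (T₁ : ℝ)..T₂, E u.toNNReal ω) (ℱ t)

end SpotPrice

theorem proposition4p3_general {Ω : Type*} {mΩ : MeasurableSpace Ω} (P : Measure Ω)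
    [IsProbabilityMeasure P] (n : ℕ) (T : ℝ≥0)
    (Λ σ : Fin n → ℝ → ℝ) (lam y : Fin n → ℝ) (ν : Fin n → Measure ℝ)
    (L Y : Fin n → ℝ≥0 → Ω → ℝ)
    (hσ_int : ∀ i, IntervalIntegrable (σ i) volume 0 T)
    (hL : ∀ i, IsIncreasingPureJumpLevy (L i) (ν i) P)
    (hL_indep : iIndepFun (fun i ω t => L i t ω) P)
    (hν : ∀ i, IntegrableOn (fun z : ℝ => z) (Ioi 0) (ν i))
    (hY : ∀ i, IsOUSolution T (lam i) (y i) (σ i) (L i) (Y i) P)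
    (T₁ T₂ : ℝ≥0) (hT₁₂ : T₁ < T₂) (hT₂ : T₂ ≤ T)
    (hΛ_int : ∀ i, IntervalIntegrable (Λ i) volume T₁ T₂) :
    (∀ᵐ ω ∂P, IntervalIntegrable (fun u : ℝ => spotPrice Λ Y u.toNNReal ω) volume T₁ T₂) ∧
    Integrable (futuresPayoff (spotPrice Λ Y) T₁ T₂) P ∧
    (∀ t : ℝ≥0, t ≤ T₁ →
      futuresPrice P (generatedFiltration L fun i => (hL i).measurable) (spotPrice Λ Y) T₁ T₂ t
        =ᵐ[P] fun ω =>
          (∑ i, Y i t ω * (1 / ((T₂ : ℝ) - T₁)) *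
            ∫ u in (T₁ : ℝ)..T₂, Λ i u * Real.exp (-lam i * (u - t)))
          + ∑ i, 1 / ((T₂ : ℝ) - T₁) *
            ∫ u in (T₁ : ℝ)..T₂, ∫ s in (t : ℝ)..u, ∫ z in Ioi (0 : ℝ),
              σ i s * Λ i u * Real.exp (-lam i * (u - s)) * z ∂(ν i)) ∧
    (∀ t : ℝ≥0, T₁ ≤ t → t ≤ T₂ →
      futuresPrice P (generatedFiltration L fun i => (hL i).measurable) (spotPrice Λ Y) T₁ T₂ t
        =ᵐ[P] fun ω =>
          1 / ((T₂ : ℝ) - T₁) * (∫ u in (T₁ : ℝ)..t, spotPrice Λ Y u.toNNReal ω)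
          + (∑ i, Y i t ω * (1 / ((T₂ : ℝ) - T₁)) *
            ∫ u in (t : ℝ)..T₂, Λ i u * Real.exp (-lam i * (u - t)))
          + ∑ i, 1 / ((T₂ : ℝ) - T₁) *
            ∫ u in (t : ℝ)..T₂, ∫ s in (t : ℝ)..u, ∫ z in Ioi (0 : ℝ),
              σ i s * Λ i u * Real.exp (-lam i * (u - s)) * z ∂(ν i)) := by
  have h (i : Fin n) : IsIntegrableLevyOU T (lam i) (y i) (σ i) (ν i) (L i) (Y i) P :=
    ⟨hL i, hν i, (hσ_int i).1, hY i⟩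
  refine ⟨ae_intervalIntegrable_spotPrice h hT₁₂.le hT₂ hΛ_int,
    (integrable_integral_spotPrice h hT₁₂.le hT₂ hΛ_int).const_mul _,
    fun t ht => ?_, fun t ht₁ ht₂ => ?_⟩
  · filter_upwards [futuresPrice_ae_eq _ _ T₁ T₂ t,
      condExp_integral_spotPrice h hL_indep ht hT₁₂.le hT₂ hΛ_int] with ω hF hE
    rw [hF, hE, mul_add, mul_decayedSpotIntegral, Finset.mul_sum]
  · filter_upwards [futuresPrice_ae_eq _ _ T₁ T₂ t,
      condExp_integral_spotPrice_of_mem h hL_indep ht₁ ht₂ hT₂ hΛ_int] with ω hF hE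
    rw [hF, hE, mul_add, mul_add, mul_decayedSpotIntegral, Finset.mul_sum]

theorem proposition4p3 {Ω : Type*} {mΩ : MeasurableSpace Ω} (P : Measure Ω)
    [IsProbabilityMeasure P] (n : ℕ) (T : ℝ≥0)
    (Λ σ : Fin n → ℝ → ℝ) (lam y : Fin n → ℝ) (ν : Fin n → Measure ℝ)
    (L Y : Fin n → ℝ≥0 → Ω → ℝ)
    (hΛ_pos : ∀ i, ∀ t ∈ Icc (0 : ℝ) T, 0 < Λ i t)
    (hlam : ∀ i, 0 < lam i)
    (hσ_meas : ∀ i, Measurable (σ i))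
    (hσ_pos : ∀ i, ∀ t ∈ Icc (0 : ℝ) T, 0 < σ i t)
    (hσ_bdd : ∀ i, ∃ C : ℝ, ∀ t ∈ Icc (0 : ℝ) T, σ i t ≤ C)
    (hL : ∀ i, IsIncreasingPureJumpLevy (L i) (ν i) P)
    (hL_indep : iIndepFun (fun i ω t => L i t ω) P)
    (hν : ∀ i, IntegrableOn (fun z : ℝ => z) (Ioi 0) (ν i))
    (hY : ∀ i, IsOUSolution T (lam i) (y i) (σ i) (L i) (Y i) P)
    (T₁ T₂ : ℝ≥0) (hT₁₂ : T₁ < T₂) (hT₂ : T₂ ≤ T)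
    (hΛ_int : ∀ i, IntervalIntegrable (Λ i) volume T₁ T₂) :
    (∀ᵐ ω ∂P, IntervalIntegrable (fun u : ℝ => spotPrice Λ Y u.toNNReal ω) volume T₁ T₂) ∧
    Integrable (futuresPayoff (spotPrice Λ Y) T₁ T₂) P ∧
    (∀ t : ℝ≥0, t ≤ T₁ →
      futuresPrice P (generatedFiltration L fun i => (hL i).measurable) (spotPrice Λ Y) T₁ T₂ t
        =ᵐ[P] fun ω =>
          (∑ i, Y i t ω * (1 / ((T₂ : ℝ) - T₁)) *
            ∫ u in (T₁ : ℝ)..T₂, Λ i u * Real.exp (-lam i * (u - t)))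
          + ∑ i, 1 / ((T₂ : ℝ) - T₁) *
            ∫ u in (T₁ : ℝ)..T₂, ∫ s in (t : ℝ)..u, ∫ z in Ioi (0 : ℝ),
              σ i s * Λ i u * Real.exp (-lam i * (u - s)) * z ∂(ν i)) ∧
    (∀ t : ℝ≥0, T₁ ≤ t → t ≤ T₂ →
      futuresPrice P (generatedFiltration L fun i => (hL i).measurable) (spotPrice Λ Y) T₁ T₂ t
        =ᵐ[P] fun ω =>
          1 / ((T₂ : ℝ) - T₁) * (∫ u in (T₁ : ℝ)..t, spotPrice Λ Y u.toNNReal ω)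
          + (∑ i, Y i t ω * (1 / ((T₂ : ℝ) - T₁)) *
            ∫ u in (t : ℝ)..T₂, Λ i u * Real.exp (-lam i * (u - t)))
          + ∑ i, 1 / ((T₂ : ℝ) - T₁) *
            ∫ u in (t : ℝ)..T₂, ∫ s in (t : ℝ)..u, ∫ z in Ioi (0 : ℝ),
              σ i s * Λ i u * Real.exp (-lam i * (u - s)) * z ∂(ν i)) := by
  refine proposition4p3_general P n T Λ σ lam y ν L Y (fun i => ?_) hL hL_indep hν hY T₁ T₂ hT₁₂ hT₂
    hΛ_int
  obtain ⟨C, hC⟩ := hσ_bdd i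
  refine (intervalIntegrable_iff_integrableOn_Icc_of_le T.coe_nonneg).2 <|
    Measure.integrableOn_of_bounded (M := C) (by simp) (hσ_meas i).aestronglyMeasurable <|
      ae_restrict_of_forall_mem measurableSet_Icc fun s hs => ?_
  exact (abs_of_pos (hσ_pos i s hs)).trans_le (hC s hs)
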